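/- **Fundamental category of the directed circle.** A *d-space* is a topological space $X$ with a set $dX$ of continuous maps $[0,1]\to X$ (directed paths) that contains the constant maps and is closed under precomposition with (weakly) increasing continuous maps $[0,1]\to[0,1]$ and under concatenation; a *d-map* is a continuous map that preserves directed paths. Let $\uparrow\mathbf I$ be $[0,1]$ with the increasing continuous maps $[0,1]\to[0,1]$ as directed paths, and let $\uparrow\mathbf I^2$ be its square, where a path is directed iff both of its components are. The *fundamental category* $\uparrow\Pi_1(X)$ has the points of $X$ as objects; its arrows $x\to x'$ are the directed paths from $x$ to $x'$ modulo the equivalence relation generated by: $a\sim b$ if there is a d-map $A:\uparrow\mathbf I^2\to X$ with $A(0,s)=x$, $A(1,s)=x'$, $A(t,0)=a(t)$, $A(t,1)=b(t)$ for all $s,t$. Composition is induced by concatenation, and identities are the classes of constant paths. There is a comparison functor $\uparrow\Pi_1(X)\to\Pi_1(X)$ to the fundamental groupoid of the underlying space, $x\mapsto x$, $[a]\mapsto[a]$. The *fundamental monoid* at $x$ is $\uparrow\pi_1(X,x)=\uparrow\Pi_1(X)(x,x)$. Let $\uparrow\mathbf S^1$ be the unit circle in $\mathbf C$ whose directed paths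 are the anticlockwise ones, i.e. the paths $a(t)=e^{i\vartheta(t)}$ with $\vartheta:[0,1]\to\mathbf R$ continuous and (weakly) increasing. Then: 1. The comparison functor induces an isomorphism of categories from $\uparrow\Pi_1(\uparrow\mathbf S^1)$ onto the subcategory of the fundamental groupoid $\Pi_1(\mathbf S^1)$ which has all points as objects and the homotopy classes (relative to the endpoints) of anticlockwise paths as arrows. 2. For every $x\in\mathbf S^1$ the monoid $\uparrow\pi_1(\uparrow\mathbf S^1,x)$ is isomorphic to the additive monoid $\mathbf N=\{0,1,2,\dots\}$. -/

import Mathlib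

open CategoryTheory unitInterval

/-- A d-structure on a topological space: a set of continuous maps `I → X`, the directed paths,
containing the constant maps and closed under increasing reparametrisation and concatenation. -/
structure DStructure (X : Type*) [TopologicalSpace X] where
  dpaths : Set C(I, X)
  const_mem : ∀ x : X, ContinuousMap.const I x ∈ dpaths
  reparam_mem : ∀ a ∈ dpaths, ∀ h : C(I, I), Monotone h → a.comp h ∈ dpaths
  trans_mem : ∀ {x y z : X} (p : Path x y) (q : Path y z), p.toContinuousMap ∈ dpaths →
    q.toContinuousMap ∈ dpaths → (p.trans q).toContinuousMap ∈ dpaths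

namespace DStructure

variable {X Y : Type*} [TopologicalSpace X] [TopologicalSpace Y]

/-- A directed map: a continuous map which preserves directed paths. -/
def IsDMap (D : DStructure X) (E : DStructure Y) (f : C(X, Y)) : Prop :=
  ∀ a ∈ D.dpaths, f.comp a ∈ E.dpaths

/-- The product d-structure: a path is directed iff both of its components are. -/
def prod (D : DStructure X) (E : DStructure Y) : DStructure (X × Y) where
  dpaths := {a | ContinuousMap.fst.comp a ∈ D.dpaths ∧ ContinuousMap.snd.comp a ∈ E.dpaths}
  const_mem x := ⟨D.const_mem x.1, E.const_mem x.2⟩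
  reparam_mem a ha h hh := ⟨D.reparam_mem _ ha.1 h hh, E.reparam_mem _ ha.2 h hh⟩
  trans_mem p q hp hq := by
    constructor
    · have := D.trans_mem (p.map continuous_fst) (q.map continuous_fst) hp.1 hq.1
      rw [← Path.map_trans] at this
      exact this
    · have := E.trans_mem (p.map continuous_snd) (q.map continuous_snd) hp.2 hq.2
      rw [← Path.map_trans] at this
      exact this

theorem monotone_trans {α : Type*} [TopologicalSpace α] [Preorder α] {x y z : α}
    (p : Path x y) (q : Path y z) (hp : Monotone p) (hq : Monotone q) :
    Monotone (p.trans q) := by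
  intro s t hst
  have hst' : (s : ℝ) ≤ t := hst
  rw [Path.trans_apply, Path.trans_apply]
  split_ifs with h1 h2 h2
  · exact hp (Subtype.mk_le_mk.2 (by linarith))
  · calc _ ≤ p 1 := hp le_one'
      _ = q 0 := by simp
      _ ≤ _ := hq nonneg'
  · exact absurd h2 (by linarith)
  · exact hq (Subtype.mk_le_mk.2 (by linarith))

/-- The standard directed interval: directed paths are the increasing continuous maps `I → I`. -/
def interval : DStructure I where
  dpaths := {a | Monotone a}
  const_mem _ := monotone_const
  reparam_mem _ ha _ hh := ha.comp hh
  trans_mem p q hp hq := monotone_trans p q hp hq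

/-- The standard directed circle: directed paths are the `t ↦ exp (i θ(t))` with `θ` increasing. -/
noncomputable def circle : DStructure Circle where
  dpaths := {a | ∃ θ : C(I, ℝ), Monotone θ ∧ ∀ t, a t = Circle.exp (θ t)}
  const_mem z := ⟨ContinuousMap.const I (Complex.arg z), monotone_const,
    fun _ => (Circle.exp_arg z).symm⟩
  reparam_mem := by
    rintro a ⟨θ, hθ, ha⟩ h hh
    exact ⟨θ.comp h, hθ.comp hh, fun t => ha (h t)⟩
  trans_mem := by
    rintro x y z p q ⟨θ, hθ, hp⟩ ⟨η, hη, hq⟩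
    have hp' : ∀ t, p t = Circle.exp (θ t) := hp
    have hq' : ∀ t, q t = Circle.exp (η t) := hq
    have h1 : Circle.exp (θ 1) = Circle.exp (η 0) := by
      rw [← hp', ← hq', p.target, q.source]
    obtain ⟨m, hm⟩ := Circle.exp_eq_exp.1 h1
    let P : Path (θ 0) (θ 1) := ⟨θ, rfl, rfl⟩
    let Q : Path (θ 1) (η 1 + m * (2 * Real.pi)) :=
      ⟨⟨fun t => η t + m * (2 * Real.pi), by fun_prop⟩, hm.symm, rfl⟩
    refine ⟨(P.trans Q).toContinuousMap,
      monotone_trans P Q hθ (fun s t h => add_le_add_left (hη h) _), fun t => ?_⟩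
    change (p.trans q) t = Circle.exp ((P.trans Q) t)
    rw [Path.trans_apply, Path.trans_apply]
    split_ifs with h
    · exact hp' _
    · rw [hq']
      exact Circle.exp_eq_exp.2 ⟨-m, by simp [Q]⟩

/-- A directed path from `x` to `y`. -/
structure DPath (D : DStructure X) (x y : X) where
  path : Path x y
  directed : path.toContinuousMap ∈ D.dpaths

/-- A 2-path (directed 2-homotopy) from `p` to `q`: a directed map defined on the directed square,
degenerate on the two sides `t = 0` and `t = 1`, equal to `p` at `s = 0` and to `q` at `s = 1`. -/
structure TwoPath (D : DStructure X) {x y : X} (p q : D.DPath x y) where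
  map : C(I × I, X)
  directed : (interval.prod interval).IsDMap D map
  map_zero_left : ∀ s, map (0, s) = x
  map_one_left : ∀ s, map (1, s) = y
  map_zero_right : ∀ t, map (t, 0) = p.path t
  map_one_right : ∀ t, map (t, 1) = q.path t

variable (D : DStructure X) {x y z : X}

/-- The 2-homotopy classes of directed paths from `x` to `y`: the quotient by the equivalence
relation spanned by the existence of a 2-path. -/
def HomotopyClass (x y : X) : Type _ :=
  Quot (fun p q : D.DPath x y => Nonempty (D.TwoPath p q))

namespace DPath

variable {D}

/-- The constant directed path. -/
def refl (D : DStructure X) (x : X) : D.DPath x x := ⟨Path.refl x, D.const_mem x⟩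

/-- Concatenation of directed paths. -/
noncomputable def trans (p : D.DPath x y) (q : D.DPath y z) : D.DPath x z :=
  ⟨p.path.trans q.path, D.trans_mem _ _ p.directed q.directed⟩

/-- The 2-homotopy class of a directed path. -/
def cls (p : D.DPath x y) : D.HomotopyClass x y := Quot.mk _ p

end DPath

variable {D}

/-- A continuous path is directed as soon as its restrictions to `[0, c]` and `[c, 1]` are. -/
theorem mem_of_split (γ : C(I, X)) (c : I) (h0 : 0 < (c : ℝ)) (h1 : (c : ℝ) < 1)
    (f g : C(I, I)) (hf : ∀ t, (f t : ℝ) = c * t) (hg : ∀ t, (g t : ℝ) = c + (1 - c) * t)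
    (hl : γ.comp f ∈ D.dpaths) (hr : γ.comp g ∈ D.dpaths) : γ ∈ D.dpaths := by
  have hd : (0 : ℝ) < 1 - c := by linarith
  let p : Path (γ 0) (γ c) := ⟨γ.comp f, congrArg γ (Subtype.ext (by simp [hf])),
    congrArg γ (Subtype.ext (by simp [hf]))⟩
  let q : Path (γ c) (γ 1) := ⟨γ.comp g, congrArg γ (Subtype.ext (by simp [hg])),
    congrArg γ (Subtype.ext (by simp [hg]))⟩
  let φ : C(I, I) := ⟨fun t => Set.projIcc (0 : ℝ) 1 zero_le_one
    (if (t : ℝ) ≤ c then t / (2 * c) else 1 / 2 + (t - c) / (2 * (1 - c))),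
    continuous_projIcc.comp (Continuous.if_le (by fun_prop) (by fun_prop) (by fun_prop)
      (by fun_prop) (fun t ht => by rw [ht]; field_simp; ring))⟩
  have hφm : Monotone φ := by
    intro s t hst
    have hst' : (s : ℝ) ≤ t := hst
    refine Set.monotone_projIcc zero_le_one ?_
    split_ifs with h1 h2 h2
    · gcongr
    · have e1 : (s : ℝ) / (2 * c) ≤ 1 / 2 := by
        rw [div_le_div_iff₀ (by positivity) (by norm_num)]; linarith
      have e2 : 0 ≤ ((t : ℝ) - c) / (2 * (1 - c)) := div_nonneg (by linarith) (by linarith)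
      linarith
    · exact absurd h2 (by linarith)
    · gcongr
  have key : γ = (p.trans q).toContinuousMap.comp φ := by
    ext t
    change γ t = (p.trans q) (φ t)
    have t1 := t.2.2
    have t0 := t.2.1
    by_cases ht : (t : ℝ) ≤ c
    · have hv : (φ t : ℝ) = t / (2 * c) := by
        have : (t : ℝ) / (2 * c) ∈ Set.Icc (0 : ℝ) 1 :=
          ⟨by positivity, by rw [div_le_one (by positivity)]; linarith⟩
        simp only [φ, ContinuousMap.coe_mk, if_pos ht, Set.projIcc_of_mem zero_le_one this]
      have hle : (φ t : ℝ) ≤ 1 / 2 := by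
        rw [hv, div_le_div_iff₀ (by positivity) (by norm_num)]; linarith
      rw [Path.trans_apply, dif_pos hle]
      refine congrArg γ (Subtype.ext ?_)
      rw [hf]
      simp only [hv]
      field_simp
    · have hct : (c : ℝ) < t := not_le.1 ht
      have hpos : 0 < ((t : ℝ) - c) / (2 * (1 - c)) := div_pos (by linarith) (by linarith)
      have hle1 : ((t : ℝ) - c) / (2 * (1 - c)) ≤ 1 / 2 := by
        rw [div_le_div_iff₀ (by linarith) (by norm_num)]; linarith
      have hv : (φ t : ℝ) = 1 / 2 + (t - c) / (2 * (1 - c)) := by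
        have : 1 / 2 + ((t : ℝ) - c) / (2 * (1 - c)) ∈ Set.Icc (0 : ℝ) 1 :=
          ⟨by linarith, by linarith⟩
        simp only [φ, ContinuousMap.coe_mk, if_neg ht, Set.projIcc_of_mem zero_le_one this]
      have hnle : ¬ (φ t : ℝ) ≤ 1 / 2 := by rw [hv]; linarith
      rw [Path.trans_apply, dif_neg hnle]
      refine congrArg γ (Subtype.ext ?_)
      rw [hg]
      simp only [hv]
      field_simp
      ring
  rw [key]
  exact D.reparam_mem _ (D.trans_mem p q hl hr) φ hφm

/-- Pasting of 2-paths along consecutive directed paths. -/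
theorem twoPath_trans {p p' : D.DPath x y} {q q' : D.DPath y z} (A : D.TwoPath p p')
    (B : D.TwoPath q q') : Nonempty (D.TwoPath (p.trans q) (p'.trans q')) := by
  let l : C(I, I) := ⟨fun t => Set.projIcc (0 : ℝ) 1 zero_le_one (2 * t), by fun_prop⟩
  let r : C(I, I) := ⟨fun t => Set.projIcc (0 : ℝ) 1 zero_le_one (2 * t - 1), by fun_prop⟩
  have hl : Monotone l := fun s t h => Set.monotone_projIcc zero_le_one (by
    have : (s : ℝ) ≤ t := h
    linarith)
  have hr : Monotone r := fun s t h => Set.monotone_projIcc zero_le_one (by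
    have : (s : ℝ) ≤ t := h
    linarith)
  have l1 : ∀ t : I, (1 / 2 : ℝ) ≤ t → l t = 1 := fun t h =>
    Set.projIcc_of_right_le zero_le_one (by linarith)
  have r0 : ∀ t : I, (t : ℝ) ≤ 1 / 2 → r t = 0 := fun t h =>
    Set.projIcc_of_le_left zero_le_one (by linarith)
  let C : C(I × I, X) := ⟨fun w => if (w.1 : ℝ) ≤ 1 / 2 then A.map (l w.1, w.2)
      else B.map (r w.1, w.2),
    Continuous.if_le (by fun_prop) (by fun_prop) (by fun_prop) (by fun_prop) (fun w hw => by
      rw [l1 _ hw.ge, r0 _ hw.le, A.map_one_left, B.map_zero_left])⟩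
  have Cl : ∀ w : I × I, (w.1 : ℝ) ≤ 1 / 2 → C w = A.map (l w.1, w.2) := fun w h => if_pos h
  have Cr : ∀ w : I × I, (1 / 2 : ℝ) ≤ w.1 → C w = B.map (r w.1, w.2) := fun w h => by
    rcases h.eq_or_lt with h | h
    · rw [Cl _ h.ge, l1 _ h.le, r0 _ h.ge, A.map_one_left, B.map_zero_left]
    · exact if_neg (not_le.2 h)
  have dl : ∀ a ∈ (interval.prod interval).dpaths, (∀ t, ((a t).1 : ℝ) ≤ 1 / 2) →
      C.comp a ∈ D.dpaths := fun a ha h => by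
    have := A.directed ⟨fun t => (l (a t).1, (a t).2), by fun_prop⟩ ⟨hl.comp ha.1, ha.2⟩
    convert this using 1
    ext t
    exact Cl _ (h t)
  have dr : ∀ a ∈ (interval.prod interval).dpaths, (∀ t, (1 / 2 : ℝ) ≤ (a t).1) →
      C.comp a ∈ D.dpaths := fun a ha h => by
    have := B.directed ⟨fun t => (r (a t).1, (a t).2), by fun_prop⟩ ⟨hr.comp ha.1, ha.2⟩
    convert this using 1
    ext t
    exact Cr _ (h t)
  refine ⟨⟨C, fun a ha => ?_, fun s => ?_, fun s => ?_, fun t => ?_, fun t => ?_⟩⟩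
  · have hm : ∀ s t : I, s ≤ t → ((a s).1 : ℝ) ≤ (a t).1 := fun s t h => ha.1 h
    by_cases h1 : ((a 1).1 : ℝ) ≤ 1 / 2
    · exact dl a ha fun t => (hm t 1 le_one').trans h1
    by_cases h0 : (1 / 2 : ℝ) ≤ (a 0).1
    · exact dr a ha fun t => h0.trans (hm 0 t nonneg')
    push Not at h0 h1
    obtain ⟨c, hc⟩ : ∃ c : I, ((a c).1 : ℝ) = 1 / 2 :=
      mem_range_of_exists_le_of_exists_ge (f := fun t : I => ((a t).1 : ℝ)) (by fun_prop)
        ⟨0, h0.le⟩ ⟨1, h1.le⟩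
    have c0 : 0 < (c : ℝ) := lt_of_le_of_ne c.2.1 fun h => by
      have : c = 0 := Subtype.ext h.symm
      rw [this] at hc
      linarith
    have c1 : (c : ℝ) < 1 := lt_of_le_of_ne c.2.2 fun h => by
      have : c = 1 := Subtype.ext h
      rw [this] at hc
      linarith
    let f : C(I, I) := ⟨fun t => ⟨c * t, by
      have := t.2.1; have := t.2.2
      exact ⟨by positivity, by nlinarith⟩⟩, by fun_prop⟩
    let g : C(I, I) := ⟨fun t => ⟨c + (1 - c) * t, by
      have := t.2.1; have := t.2.2
      exact ⟨by nlinarith, by nlinarith⟩⟩, by fun_prop⟩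
    have hf : Monotone f := fun s t h => Subtype.mk_le_mk.2 (by
      have : (s : ℝ) ≤ t := h
      nlinarith)
    have hg : Monotone g := fun s t h => Subtype.mk_le_mk.2 (by
      have : (s : ℝ) ≤ t := h
      nlinarith)
    refine mem_of_split (C.comp a) c c0 c1 f g (fun _ => rfl) (fun _ => rfl) ?_ ?_
    · refine dl (a.comp f) ((interval.prod interval).reparam_mem a ha f hf) fun t => ?_
      rw [← hc]
      refine hm _ _ (Subtype.coe_le_coe.1 ?_)
      have := t.2.2
      change (c : ℝ) * t ≤ c
      nlinarith
    · refine dr (a.comp g) ((interval.prod interval).reparam_mem a ha g hg) fun t => ?_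
      rw [← hc]
      refine hm _ _ (Subtype.coe_le_coe.1 ?_)
      have := t.2.1
      change (c : ℝ) ≤ c + (1 - c) * t
      nlinarith
  · rw [Cl _ (by norm_num)]
    have : l 0 = 0 := Set.projIcc_of_le_left zero_le_one (by norm_num)
    rw [this, A.map_zero_left]
  · rw [Cr _ (by norm_num)]
    have : r 1 = 1 := Set.projIcc_of_right_le zero_le_one (by norm_num)
    rw [this, B.map_one_left]
  · change _ = (p.path.trans q.path) t
    rw [Path.trans_apply]
    split_ifs with h
    · rw [Cl _ h, A.map_zero_right]
      exact congrArg p.path (Set.projIcc_of_mem zero_le_one _)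
    · rw [Cr _ (not_le.1 h).le, B.map_zero_right]
      exact congrArg q.path (Set.projIcc_of_mem zero_le_one _)
  · change _ = (p'.path.trans q'.path) t
    rw [Path.trans_apply]
    split_ifs with h
    · rw [Cl _ h, A.map_one_right]
      exact congrArg p'.path (Set.projIcc_of_mem zero_le_one _)
    · rw [Cr _ (not_le.1 h).le, B.map_one_right]
      exact congrArg q'.path (Set.projIcc_of_mem zero_le_one _)

/-- The trivial 2-path. -/
def TwoPath.refl (p : D.DPath x y) : D.TwoPath p p where
  map := p.path.toContinuousMap.comp ContinuousMap.fst
  directed _ ha := D.reparam_mem _ p.directed _ ha.1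
  map_zero_left _ := p.path.source
  map_one_left _ := p.path.target
  map_zero_right _ := rfl
  map_one_right _ := rfl

/-- Two increasing reparametrisations `φ ≤ ψ` of a directed path are linked by a 2-path. -/
theorem cls_eq_of_le (p a b : D.DPath x y) (φ ψ : C(I, I)) (hφ : Monotone φ) (hψ : Monotone ψ)
    (hle : ∀ t, φ t ≤ ψ t) (φ0 : φ 0 = 0) (φ1 : φ 1 = 1) (ψ0 : ψ 0 = 0) (ψ1 : ψ 1 = 1)
    (ha : ∀ t, a.path t = p.path (φ t)) (hb : ∀ t, b.path t = p.path (ψ t)) :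
    a.cls = b.cls := by
  let θ : C(I × I, I) := ⟨fun w => ⟨(1 - w.2) * φ w.1 + w.2 * ψ w.1,
    (convex_Icc (0 : ℝ) 1) (φ w.1).2 (ψ w.1).2 (by linarith [w.2.2.2]) w.2.2.1 (by ring)⟩,
    by fun_prop⟩
  refine Quot.sound ⟨⟨p.path.toContinuousMap.comp θ, fun c hc => ?_, fun s => ?_, fun s => ?_,
    fun t => ?_, fun t => ?_⟩⟩
  · refine D.reparam_mem _ p.directed (θ.comp c) fun s t hst => Subtype.mk_le_mk.2 ?_
    have e1 : (φ (c s).1 : ℝ) ≤ φ (c t).1 := hφ (hc.1 hst)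
    have e2 : (ψ (c s).1 : ℝ) ≤ ψ (c t).1 := hψ (hc.1 hst)
    have e3 : ((c s).2 : ℝ) ≤ (c t).2 := hc.2 hst
    have e4 : (φ (c t).1 : ℝ) ≤ ψ (c t).1 := hle _
    have e5 := (c s).2.2.1
    have e6 := (c s).2.2.2
    nlinarith [mul_nonneg (sub_nonneg.2 e6) (sub_nonneg.2 e1), mul_nonneg e5 (sub_nonneg.2 e2),
      mul_nonneg (sub_nonneg.2 e3) (sub_nonneg.2 e4)]
  · have : θ (0, s) = 0 := Subtype.ext (by simp [θ, φ0, ψ0])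
    change p.path (θ (0, s)) = x
    rw [this, p.path.source]
  · have : θ (1, s) = 1 := Subtype.ext (by simp [θ, φ1, ψ1])
    change p.path (θ (1, s)) = y
    rw [this, p.path.target]
  · rw [ha]
    exact congrArg p.path (Subtype.ext (by simp [θ]))
  · rw [hb]
    exact congrArg p.path (Subtype.ext (by simp [θ]))

/-- An increasing reparametrisation fixing the endpoints does not change the 2-homotopy class. -/
theorem cls_reparam (p a : D.DPath x y) (φ : I → I) (hc : Continuous φ) (hφ : Monotone φ)
    (φ0 : φ 0 = 0) (φ1 : φ 1 = 1) (ha : a.path = p.path.reparam φ hc φ0 φ1) :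
    a.cls = p.cls := by
  let m : C(I, I) := ⟨fun t => φ t ⊔ t, by fun_prop⟩
  have hm : Monotone m := fun s t h => sup_le_sup (hφ h) h
  have m0 : m 0 = 0 := by simp [m, φ0]
  have m1 : m 1 = 1 := by simp [m, φ1]
  let b : D.DPath x y := ⟨p.path.reparam m m.continuous m0 m1, D.reparam_mem _ p.directed m hm⟩
  have h1 : a.cls = b.cls := cls_eq_of_le p a b ⟨φ, hc⟩ m hφ hm (fun t => le_sup_left) φ0 φ1 m0 m1
    (fun t => by rw [ha]; rfl) (fun t => rfl)
  have h2 : p.cls = b.cls := cls_eq_of_le p p b (ContinuousMap.id I) m monotone_id hm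
    (fun t => le_sup_right) rfl rfl m0 m1 (fun t => rfl) (fun t => rfl)
  rw [h1, h2]

theorem cls_trans_refl (p : D.DPath x y) : (p.trans (DPath.refl D y)).cls = p.cls := by
  refine cls_reparam p _ _ (by fun_prop) ?_ (Subtype.ext Path.Homotopy.transReflReparamAux_zero)
    (Subtype.ext Path.Homotopy.transReflReparamAux_one) (Path.Homotopy.trans_refl_reparam p.path)
  intro s t h
  have h' : (s : ℝ) ≤ t := h
  refine Subtype.mk_le_mk.2 ?_
  unfold Path.Homotopy.transReflReparamAux
  split_ifs <;> linarith

theorem cls_refl_trans (p : D.DPath x y) : ((DPath.refl D x).trans p).cls = p.cls := by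
  refine cls_reparam p _ (fun t => Set.projIcc (0 : ℝ) 1 zero_le_one (2 * t - 1)) (by fun_prop)
    (fun s t h => Set.monotone_projIcc zero_le_one ?_)
    (Set.projIcc_of_le_left zero_le_one (by norm_num))
    (Set.projIcc_of_right_le zero_le_one (by norm_num)) ?_
  · have h' : (s : ℝ) ≤ t := h
    linarith
  · ext t
    change ((Path.refl x).trans p.path) t = p.path (Set.projIcc (0 : ℝ) 1 zero_le_one (2 * t - 1))
    rw [Path.trans_apply]
    split_ifs with h
    · rw [Set.projIcc_of_le_left zero_le_one (by linarith)]
      exact p.path.source.symm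
    · exact congrArg p.path (Set.projIcc_of_mem zero_le_one _).symm

theorem cls_trans_assoc {w : X} (p : D.DPath x y) (q : D.DPath y z) (r : D.DPath z w) :
    ((p.trans q).trans r).cls = (p.trans (q.trans r)).cls := by
  refine cls_reparam _ _ _ (by fun_prop) ?_
    (Subtype.ext Path.Homotopy.transAssocReparamAux_zero)
    (Subtype.ext Path.Homotopy.transAssocReparamAux_one)
    (Path.Homotopy.trans_assoc_reparam p.path q.path r.path)
  intro s t h
  have h' : (s : ℝ) ≤ t := h
  refine Subtype.mk_le_mk.2 ?_
  unfold Path.Homotopy.transAssocReparamAux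
  split_ifs <;> linarith

/-- Concatenation of 2-homotopy classes. -/
noncomputable def HomotopyClass.trans (f : D.HomotopyClass x y) (g : D.HomotopyClass y z) :
    D.HomotopyClass x z :=
  Quot.map₂ DPath.trans (fun p _ _ ⟨B⟩ => twoPath_trans (TwoPath.refl p) B)
    (fun _ _ q ⟨A⟩ => twoPath_trans A (TwoPath.refl q)) f g

/-- A 2-path is in particular a homotopy relative to the endpoints. -/
theorem TwoPath.homotopic {p q : D.DPath x y} (A : D.TwoPath p q) : p.path.Homotopic q.path :=
  ⟨{  toFun := fun w => A.map (w.2, w.1)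
      continuous_toFun := by fun_prop
      map_zero_left := A.map_zero_right
      map_one_left := A.map_one_right
      prop' := by
        rintro s t (rfl | rfl)
        · exact (A.map_zero_left s).trans p.path.source.symm
        · exact (A.map_one_left s).trans p.path.target.symm }⟩

end DStructure

/-- The fundamental category of a d-space: objects are the points, arrows the 2-homotopy classes
of directed paths, composition is concatenation. -/
structure FundamentalCategory {X : Type*} [TopologicalSpace X] (D : DStructure X) where
  as : X

namespace FundamentalCategory

open DStructure

variable {X : Type*} [TopologicalSpace X] (D : DStructure X)

noncomputable instance : Category (FundamentalCategory D) where
  Hom x y := D.HomotopyClass x.as y.as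
  id x := (DPath.refl D x.as).cls
  comp f g := HomotopyClass.trans f g
  id_comp := by rintro _ _ ⟨p⟩; exact cls_refl_trans p
  comp_id := by rintro _ _ ⟨p⟩; exact cls_trans_refl p
  assoc := by rintro _ _ _ _ ⟨p⟩ ⟨q⟩ ⟨r⟩; exact cls_trans_assoc p q r

/-- The comparison functor to the fundamental groupoid, `x ↦ x` and `[a] ↦ [a]`. -/
noncomputable def comparison : FundamentalCategory D ⥤ FundamentalGroupoid X where
  obj x := ⟨x.as⟩
  map f := Quot.lift (fun p => Path.Homotopic.Quotient.mk p.path)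
    (fun _ _ ⟨A⟩ => Quotient.sound A.homotopic) f
  map_id _ := rfl
  map_comp := by rintro _ _ _ ⟨p⟩ ⟨q⟩; rfl

/-- The arrows of the fundamental groupoid which are classes of directed paths. -/
def directedClasses : MorphismProperty (FundamentalGroupoid X) := fun x y f =>
  ∃ p : Path x.as y.as, p.toContinuousMap ∈ D.dpaths ∧ Path.Homotopic.Quotient.mk p = f

instance : (directedClasses D).IsMultiplicative where
  id_mem x := ⟨Path.refl x.as, D.const_mem x.as, rfl⟩
  comp_mem := by
    rintro _ _ _ _ _ ⟨p, hp, rfl⟩ ⟨q, hq, rfl⟩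
    exact ⟨p.trans q, D.trans_mem p q hp hq, rfl⟩

/-- The fundamental monoid at `x`: the endomorphisms of `x` in the fundamental category. -/
abbrev FundamentalMonoid (x : X) : Type _ := End (FundamentalCategory.mk (D := D) x)

end FundamentalCategory

/-! A path on the circle lifts through the covering `Circle.exp` to an angle function, unique up to
adding a multiple of 2π, so its total increment is well defined. Homotopies relative to the
endpoints lift as well, so homotopic paths have the same increment
(`angle_increment_eq_of_homotopic`). A 2-path is such a homotopy, hence the increment descends to
2-homotopy classes as `sweep`.

Conversely, two anticlockwise paths with the same ends and the same sweep have increasing angle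
functions with common end values, after a shift by a multiple of 2π. Their pointwise maximum is
again increasing, and linear interpolation from either one up to the maximum is directed, which
gives two 2-paths (`sweep_injective`). Thus homotopic anticlockwise paths are already 2-homotopic:
the comparison functor is faithful. It is bijective on objects and, by the choice of subcategory,
full onto its target, hence an isomorphism.

For loops the sweep is 2πn with n a natural number. It is additive under concatenation, injective,
and takes every such value, so counting turns identifies the fundamental monoid with the natural
numbers. -/

namespace DStructure

/-- Angle functions of two homotopic paths on the circle have the same total increment. -/
theorem angle_increment_eq_of_homotopic {x y : Circle} {p q : Path x y} (h : p.Homotopic q)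
    (θ η : C(I, ℝ)) (hθ : ∀ t, p t = Circle.exp (θ t)) (hη : ∀ t, q t = Circle.exp (η t)) :
    θ 1 - θ 0 = η 1 - η 0 := by
  have h0 : Circle.exp (θ 0) = Circle.exp (η 0) := by
    rw [← hθ, ← hη, p.source, q.source]
  obtain ⟨m, hm⟩ := Circle.exp_eq_exp.1 h0
  -- After this shift both angle functions are lifts starting at `θ 0`, so homotopy lifting forces
  -- their end values to agree.
  let η' : C(I, ℝ) := ⟨fun t => η t + m * (2 * Real.pi), by fun_prop⟩
  have hη' : ∀ t, q t = Circle.exp (η' t) := fun t =>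
    (hη t).trans (Circle.exp_eq_exp.2 ⟨-m, by simp [η']⟩)
  have key := Circle.isCoveringMap_exp.liftPath_apply_one_eq_of_homotopicRel h (θ 0) (hθ 0)
    ((hη' 0).trans (congrArg Circle.exp hm.symm))
  rw [← (Circle.isCoveringMap_exp.eq_liftPath_iff' (hθ 0)).2 ⟨funext fun t => (hθ t).symm, rfl⟩,
    ← (Circle.isCoveringMap_exp.eq_liftPath_iff' _).2
      ⟨funext fun t => (hη' t).symm, hm.symm⟩] at key
  change θ 1 = η 1 + m * (2 * Real.pi) at key
  linarith

/-! ### The swept angle as a complete invariant -/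

namespace HomotopyClass

variable {x y z : Circle}

/-- The total angle swept by a class of anticlockwise paths. -/
noncomputable def sweep (f : circle.HomotopyClass x y) : ℝ :=
  Quot.lift (fun p : circle.DPath x y => p.directed.choose 1 - p.directed.choose 0)
    (fun p q ⟨A⟩ => angle_increment_eq_of_homotopic A.homotopic _ _
      p.directed.choose_spec.2 q.directed.choose_spec.2) f

/-- Frees `sweep` from the chosen angle function: the increment lemma is applied to the constant
homotopy. -/
theorem sweep_cls (p : circle.DPath x y) (θ : C(I, ℝ)) (hθ : ∀ t, p.path t = Circle.exp (θ t)) :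
    sweep p.cls = θ 1 - θ 0 :=
  angle_increment_eq_of_homotopic (Path.Homotopic.refl p.path) _ _ p.directed.choose_spec.2 hθ

theorem sweep_trans (f : circle.HomotopyClass x y) (g : circle.HomotopyClass y z) :
    sweep (f.trans g) = sweep f + sweep g := by
  obtain ⟨p⟩ := f
  obtain ⟨q⟩ := g
  obtain ⟨θ, -, hp⟩ := p.directed
  obtain ⟨η, -, hq⟩ := q.directed
  have hp' : ∀ t, p.path t = Circle.exp (θ t) := hp
  have hq' : ∀ t, q.path t = Circle.exp (η t) := hq
  obtain ⟨m, hm⟩ := Circle.exp_eq_exp.1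
    (show Circle.exp (θ 1) = Circle.exp (η 0) by rw [← hp', ← hq', p.path.target, q.path.source])
  -- Shifting `η` by `2πm` makes it start where `θ` ends, so the concatenated angle functions lift
  -- the concatenated path.
  let P : Path (θ 0) (θ 1) := ⟨θ, rfl, rfl⟩
  let Q : Path (θ 1) (η 1 + m * (2 * Real.pi)) :=
    ⟨⟨fun t => η t + m * (2 * Real.pi), by fun_prop⟩, hm.symm, rfl⟩
  have hPQ : ∀ t, (p.trans q).path t = Circle.exp ((P.trans Q) t) := fun t => by
    change (p.path.trans q.path) t = _
    rw [Path.trans_apply, Path.trans_apply]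
    split_ifs with h
    · exact hp' _
    · rw [hq']
      exact Circle.exp_eq_exp.2 ⟨-m, by simp [Q]⟩
  change sweep (p.trans q).cls = sweep p.cls + sweep q.cls
  rw [sweep_cls (p.trans q) (P.trans Q).toContinuousMap hPQ, sweep_cls p θ hp',
    sweep_cls q η hq']
  change (P.trans Q) 1 - (P.trans Q) 0 = _
  rw [(P.trans Q).source, (P.trans Q).target]
  linarith

/-- If `θ ≤ η` are increasing angle functions with the same ends, linear interpolation is a
2-path. -/
theorem cls_eq_of_angle_le (p q : circle.DPath x y) (θ η : C(I, ℝ)) (hθ : Monotone θ)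
    (hη : Monotone η) (hle : ∀ t, θ t ≤ η t) (h0 : θ 0 = η 0) (h1 : θ 1 = η 1)
    (hp : ∀ t, p.path t = Circle.exp (θ t)) (hq : ∀ t, q.path t = Circle.exp (η t)) :
    p.cls = q.cls := by
  let H : C(I × I, ℝ) := ⟨fun w => (1 - w.2) * θ w.1 + w.2 * η w.1, by fun_prop⟩
  refine Quot.sound ⟨⟨Circle.exp.comp H, ?_, fun s => ?_, fun s => ?_, fun t => ?_, fun t => ?_⟩⟩
  · refine fun c hc => ⟨H.comp c, fun s t hst => ?_, fun t => rfl⟩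
    change (1 - ((c s).2 : ℝ)) * θ (c s).1 + (c s).2 * η (c s).1 ≤
      (1 - ((c t).2 : ℝ)) * θ (c t).1 + (c t).2 * η (c t).1
    have e1 : θ (c s).1 ≤ θ (c t).1 := hθ (hc.1 hst)
    have e2 : η (c s).1 ≤ η (c t).1 := hη (hc.1 hst)
    have e3 : ((c s).2 : ℝ) ≤ (c t).2 := hc.2 hst
    -- With σ ≤ τ the second coordinates of `c s`, `c t`, the increment of `H` is (1 - σ)Δθ + σΔη +
    -- (τ - σ)(η - θ), the last factor taken at `(c t).1`. Nonnegativity of the last term is where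
    -- `θ ≤ η` enters.
    nlinarith [mul_nonneg (sub_nonneg.2 (c s).2.2.2) (sub_nonneg.2 e1),
      mul_nonneg (c s).2.2.1 (sub_nonneg.2 e2),
      mul_nonneg (sub_nonneg.2 e3) (sub_nonneg.2 (hle (c t).1))]
  · have : H (0, s) = θ 0 := by simp only [H, ContinuousMap.coe_mk, ← h0]; ring
    rw [ContinuousMap.comp_apply, this, ← p.path.source, hp]
  · have : H (1, s) = θ 1 := by simp only [H, ContinuousMap.coe_mk, ← h1]; ring
    rw [ContinuousMap.comp_apply, this, ← p.path.target, hp]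
  · have : H (t, 0) = θ t := by simp [H]
    rw [ContinuousMap.comp_apply, this, hp]
  · have : H (t, 1) = η t := by simp [H]
    rw [ContinuousMap.comp_apply, this, hq]

/-- A class of anticlockwise paths with given ends is determined by the angle it sweeps. -/
theorem sweep_injective : Function.Injective (sweep (x := x) (y := y)) := by
  rintro ⟨p⟩ ⟨q⟩ h
  obtain ⟨θ, hθ, hp⟩ := p.directed
  obtain ⟨η₀, hη₀, hq₀⟩ := q.directed
  have hp' : ∀ t, p.path t = Circle.exp (θ t) := hp
  have hq₀' : ∀ t, q.path t = Circle.exp (η₀ t) := hq₀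
  change sweep p.cls = sweep q.cls at h
  rw [sweep_cls p θ hp', sweep_cls q η₀ hq₀'] at h
  obtain ⟨m, hm⟩ := Circle.exp_eq_exp.1
    (show Circle.exp (θ 0) = Circle.exp (η₀ 0) by rw [← hp', ← hq₀', p.path.source, q.path.source])
  let η : C(I, ℝ) := ⟨fun t => η₀ t + m * (2 * Real.pi), by fun_prop⟩
  have hη : Monotone η := fun s t hst => add_le_add_left (hη₀ hst) _
  have hq : ∀ t, q.path t = Circle.exp (η t) := fun t =>
    (hq₀' t).trans (Circle.exp_eq_exp.2 ⟨-m, by simp [η]⟩)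
  have h0 : θ 0 = η 0 := hm
  have h1 : θ 1 = η 1 := by
    change θ 1 = η₀ 1 + m * (2 * Real.pi)
    linarith
  -- `θ` and `η` need not be comparable; their maximum dominates both and keeps the common end
  -- values.
  let μ : C(I, ℝ) := ⟨fun t => θ t ⊔ η t, by fun_prop⟩
  have hμ : Monotone μ := fun s t hst => sup_le_sup (hθ hst) (hη hst)
  have μ0 : θ 0 = μ 0 := by simp [μ, h0]
  have μ1 : θ 1 = μ 1 := by simp [μ, h1]
  let r : circle.DPath x y := ⟨⟨Circle.exp.comp μ,
    (congrArg Circle.exp μ0.symm).trans ((hp' 0).symm.trans p.path.source),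
    (congrArg Circle.exp μ1.symm).trans ((hp' 1).symm.trans p.path.target)⟩,
    ⟨μ, hμ, fun _ => rfl⟩⟩
  exact (cls_eq_of_angle_le p r θ μ hθ hμ (fun _ => le_sup_left) μ0 μ1 hp' fun _ => rfl).trans
    (cls_eq_of_angle_le q r η μ hη hμ (fun _ => le_sup_right) (h0.symm.trans μ0)
      (h1.symm.trans μ1) hq fun _ => rfl).symm

/-! ### Counting the turns of loops -/

theorem exists_sweep_eq_natCast_mul (f : circle.HomotopyClass x x) :
    ∃ n : ℕ, sweep f = n * (2 * Real.pi) := by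
  obtain ⟨p⟩ := f
  obtain ⟨θ, hθ, hp⟩ := p.directed
  have hp' : ∀ t, p.path t = Circle.exp (θ t) := hp
  obtain ⟨m, hm⟩ := Circle.exp_eq_exp.1
    (show Circle.exp (θ 1) = Circle.exp (θ 0) by rw [← hp', ← hp', p.path.source, p.path.target])
  -- Directedness excludes negative winding: the angle increases.
  have hm0 : 0 ≤ m := by
    have : 0 ≤ (m : ℝ) * (2 * Real.pi) := by linarith [hθ (zero_le_one : (0 : I) ≤ 1)]
    exact_mod_cast nonneg_of_mul_nonneg_left this Real.two_pi_pos
  lift m to ℕ using hm0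
  refine ⟨m, (sweep_cls p θ hp').trans ?_⟩
  push_cast at hm
  linarith

/-- The anticlockwise loop at `x` which winds `n` times at constant speed. -/
noncomputable def circleLoop (x : Circle) (n : ℕ) : circle.DPath x x where
  path :=
    { toFun := fun t => Circle.exp (Complex.arg x + n * (2 * Real.pi) * t)
      continuous_toFun := by fun_prop
      source' := by simp [Circle.exp_arg]
      target' := by
        conv_rhs => rw [← Circle.exp_arg x]
        exact Circle.exp_eq_exp.2 ⟨n, by simp⟩ }
  directed := ⟨⟨fun t => Complex.arg x + n * (2 * Real.pi) * t, by fun_prop⟩, fun s t hst => by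
    have hst' : (s : ℝ) ≤ t := hst
    have := Real.pi_pos
    change Complex.arg x + n * (2 * Real.pi) * s ≤ Complex.arg x + n * (2 * Real.pi) * t
    gcongr, fun _ => rfl⟩

theorem sweep_circleLoop (x : Circle) (n : ℕ) :
    sweep (circleLoop x n).cls = n * (2 * Real.pi) := by
  rw [sweep_cls (circleLoop x n) ⟨fun t => Complex.arg x + n * (2 * Real.pi) * t, by fun_prop⟩
    fun _ => rfl]
  simp

/-- The number of turns of a class of anticlockwise loops. -/
noncomputable def turns (f : circle.HomotopyClass x x) : ℕ :=
  f.exists_sweep_eq_natCast_mul.choose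

theorem sweep_eq_turns_mul (f : circle.HomotopyClass x x) :
    sweep f = f.turns * (2 * Real.pi) :=
  f.exists_sweep_eq_natCast_mul.choose_spec

theorem turns_eq_iff {f : circle.HomotopyClass x x} {n : ℕ} :
    f.turns = n ↔ sweep f = n * (2 * Real.pi) := by
  rw [sweep_eq_turns_mul, mul_left_inj' Real.two_pi_pos.ne', Nat.cast_inj]

theorem turns_trans (f g : circle.HomotopyClass x x) :
    (f.trans g).turns = f.turns + g.turns := by
  rw [turns_eq_iff, sweep_trans, sweep_eq_turns_mul, sweep_eq_turns_mul]
  push_cast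
  ring

theorem turns_bijective : Function.Bijective (turns (x := x)) :=
  ⟨fun f g h => sweep_injective (by rw [sweep_eq_turns_mul, sweep_eq_turns_mul, h]),
    fun n => ⟨(circleLoop x n).cls, turns_eq_iff.2 (sweep_circleLoop x n)⟩⟩

end HomotopyClass

end DStructure

/-! ### The comparison functor and the fundamental monoid -/

namespace FundamentalCategory

open DStructure

section Comparison

variable {X : Type*} [TopologicalSpace X] (D : DStructure X)

theorem directedClasses_comparison_map {x y : FundamentalCategory D} (f : x ⟶ y) :
    directedClasses D ((comparison D).map f) := by
  obtain ⟨p⟩ := f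
  exact ⟨p.path, p.directed, rfl⟩

/-- The comparison functor, with values in the subcategory of classes of directed paths. -/
noncomputable def comparisonWide : FundamentalCategory D ⥤ WideSubcategory (directedClasses D) where
  obj x := ⟨(comparison D).obj x⟩
  map f := ⟨(comparison D).map f, directedClasses_comparison_map D f⟩
  map_id x := WideSubcategory.hom_ext _ ((comparison D).map_id x)
  map_comp f g := WideSubcategory.hom_ext _ ((comparison D).map_comp f g)

instance : (comparisonWide D).Full where
  map_surjective := by
    rintro x y ⟨f, p, hp, rfl⟩
    exact ⟨(⟨p, hp⟩ : D.DPath x.as y.as).cls, rfl⟩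

variable [(comparisonWide D).Faithful]

/-- The inverse of the comparison functor onto the subcategory of classes of directed paths, when
it is faithful. -/
noncomputable def comparisonWideInverse :
    WideSubcategory (directedClasses D) ⥤ FundamentalCategory D where
  obj x := ⟨x.obj.as⟩
  -- Fullness supplies a preimage; faithfulness makes it unique, hence functorial.
  map {x y} f := (comparisonWide D).preimage (X := mk x.obj.as) (Y := mk y.obj.as) f
  map_id x := (comparisonWide D).preimage_id (X := mk x.obj.as)
  map_comp {x y z} f g := (comparisonWide D).preimage_comp (X := mk x.obj.as) (Y := mk y.obj.as)
    (Z := mk z.obj.as) f g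

theorem comparisonWide_comp_inverse : comparisonWide D ⋙ comparisonWideInverse D = 𝟭 _ :=
  Functor.hext (fun _ => rfl) fun _ _ f => heq_of_eq ((comparisonWide D).preimage_map f)

theorem comparisonWideInverse_comp : comparisonWideInverse D ⋙ comparisonWide D = 𝟭 _ :=
  Functor.hext (fun _ => rfl) fun x y f => heq_of_eq
    ((comparisonWide D).map_preimage (X := mk x.obj.as) (Y := mk y.obj.as) f)

end Comparison

/-- Homotopic paths sweep the same angle, and the sweep determines the 2-homotopy class. -/
instance : (comparisonWide circle).Faithful where
  map_injective := by
    rintro x y ⟨p⟩ ⟨q⟩ h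
    have h' : p.path.Homotopic q.path :=
      Path.Homotopic.Quotient.exact (congrArg InducedWideCategory.Hom.hom h)
    obtain ⟨θ, -, hp⟩ := p.directed
    obtain ⟨η, -, hq⟩ := q.directed
    exact HomotopyClass.sweep_injective <| (HomotopyClass.sweep_cls p θ hp).trans <|
      (angle_increment_eq_of_homotopic h' θ η hp hq).trans (HomotopyClass.sweep_cls q η hq).symm

/-- The fundamental monoid of the directed circle is the additive monoid of natural numbers. -/
noncomputable def fundamentalMonoidCircleEquiv (x : Circle) :
    FundamentalMonoid circle x ≃* Multiplicative ℕ where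
  toEquiv := (Equiv.ofBijective (HomotopyClass.turns (x := x))
    HomotopyClass.turns_bijective).trans Multiplicative.ofAdd
  map_mul' f g := congrArg Multiplicative.ofAdd
    -- In `End`, `f * g` is `g ≫ f`, whence the swapped arguments and `add_comm`.
    ((HomotopyClass.turns_trans (x := x) g f).trans (add_comm _ _))

end FundamentalCategory

theorem mainTheorem5 :
    (∃ (F : FundamentalCategory DStructure.circle ⥤
          WideSubcategory (FundamentalCategory.directedClasses DStructure.circle))
        (G : WideSubcategory (FundamentalCategory.directedClasses DStructure.circle) ⥤
          FundamentalCategory DStructure.circle),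
      F ⋙ G = 𝟭 _ ∧ G ⋙ F = 𝟭 _ ∧
      F ⋙ wideSubcategoryInclusion (FundamentalCategory.directedClasses DStructure.circle) =
        FundamentalCategory.comparison DStructure.circle) ∧
    ∀ x : Circle, Nonempty
      (FundamentalCategory.FundamentalMonoid DStructure.circle x ≃* Multiplicative ℕ) :=
  ⟨⟨FundamentalCategory.comparisonWide _, FundamentalCategory.comparisonWideInverse _,
    FundamentalCategory.comparisonWide_comp_inverse _,
    FundamentalCategory.comparisonWideInverse_comp _, rfl⟩,
    fun x => ⟨FundamentalCategory.fundamentalMonoidCircleEquiv x⟩⟩
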